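/- Let $\mathbb{K}\in\{\mathbb{R},\mathbb{C}\}$. For $1\le p<\infty$ put $X_p=\ell_p$ (scalar sequences indexed by $\mathbb{N}$), and put $X_\infty=c_0$ with the sup norm; let $(e_j)$ be the canonical unit vectors. For a continuous bilinear form $A:X_p\times X_q\to\mathbb{K}$ let $\|A\|=\sup\{|A(x,y)|:\|x\|\le 1,\ \|y\|\le 1\}$. Theorem (Hardy and Littlewood -- revisited). Let $p,q\in[2,\infty]$ with $\frac1p+\frac1q<1$ (where $\frac1\infty=0$), and let $\lambda\in[1,\infty)$ be given by $\frac1\lambda=1-\frac1p-\frac1q$, that is, $\lambda=\frac{pq}{pq-p-q}$ when $p,q<\infty$. Then: (a) There is a constant $C\ge 1$ such that, for all continuous bilinear forms $A:X_p\times X_q\to\mathbb{K}$, $$\Bigl(\sum_{k=1}^\infty\Bigl(\sum_{j=1}^\infty|A(e_j,e_k)|^2\Bigr)^{\lambda/2}\Bigr)^{1/\lambda}\le C\|A\|.$$ (b) The exponent $\lambda$ cannot be lowered while the inner exponent $2$ is kept: for every real $0<s<\lambda$ there is no constant $C$ such that $$\Bigl(\sum_{k=1}^\infty\Bigl(\sum_{j=1}^\infty|A(e_j,e_k)|^2\Bigr)^{s/2}\Bigr)^{1/s}\le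 C\|A\|$$ for all continuous bilinear forms $A:X_p\times X_q\to\mathbb{K}$. (c) The exponent $2$ cannot be lowered while $\lambda$ is kept: for every real $0<r<2$ there is no constant $C$ such that $$\Bigl(\sum_{k=1}^\infty\Bigl(\sum_{j=1}^\infty|A(e_j,e_k)|^r\Bigr)^{\lambda/r}\Bigr)^{1/\lambda}\le C\|A\|$$ for all continuous bilinear forms $A:X_p\times X_q\to\mathbb{K}$. -/

import Mathlib

open Filter Topology
open scoped ENNReal

noncomputable section

/-- The sequence space `ℓ_p` over `𝕜` for `p < ∞`, and its replacement `c₀` (the null sequences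
with the sup norm) for `p = ∞`, as a subspace of Mathlib's `ℓ_p` with the inherited norm. -/
def seqSpace (𝕜 : Type*) [RCLike 𝕜] (p : ℝ≥0∞) : Submodule 𝕜 (lp (fun _ : ℕ => 𝕜) p) where
  carrier := {x | p = ∞ → Tendsto (fun n : ℕ => x n) atTop (𝓝 0)}
  add_mem' := by
    intro x y hx hy h
    simpa using (hx h).add (hy h)
  zero_mem' := by
    intro _
    simp
  smul_mem' := by
    intro c x hx h
    simpa using (hx h).const_mul c

instance seqSpaceNormedAddCommGroup (𝕜 : Type*) [RCLike 𝕜] (p : ℝ≥0∞) [Fact (1 ≤ p)] :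
    NormedAddCommGroup (seqSpace 𝕜 p) := Submodule.normedAddCommGroup _

instance seqSpaceNormedSpace (𝕜 : Type*) [RCLike 𝕜] (p : ℝ≥0∞) [Fact (1 ≤ p)] :
    NormedSpace 𝕜 (seqSpace 𝕜 p) := Submodule.normedSpace _

/-- The canonical vector `e_j` of `ℓ_p` (of `c₀` if `p = ∞`). -/
def seqBasis (𝕜 : Type*) [RCLike 𝕜] (p : ℝ≥0∞) (j : ℕ) : seqSpace 𝕜 p :=
  ⟨lp.single p j (1 : 𝕜), by
    intro _
    refine tendsto_const_nhds.congr' ?_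
    filter_upwards [eventually_gt_atTop j] with n hn
    simp [lp.single_apply, hn.ne']⟩

/-- Continuous bilinear forms on `ℓ_p × ℓ_q` (with `c₀` in place of `ℓ_∞`); the norm is
`‖A‖ = sup {|A (x, y)| : ‖x‖ ≤ 1, ‖y‖ ≤ 1}`. -/
abbrev BilinForms (𝕜 : Type*) [RCLike 𝕜] (p q : ℝ≥0∞) [Fact (1 ≤ p)] [Fact (1 ≤ q)] : Type _ :=
  seqSpace 𝕜 p →L[𝕜] seqSpace 𝕜 q →L[𝕜] 𝕜

/-- The mixed sum `(∑_k (∑_j |A (e_j, e_k)| ^ r) ^ (s / r)) ^ (1 / s)`, a value in `[0, ∞]`. -/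
def mixedSum {𝕜 : Type*} [RCLike 𝕜] {p q : ℝ≥0∞} [Fact (1 ≤ p)] [Fact (1 ≤ q)]
    (A : BilinForms 𝕜 p q) (r s : ℝ) : ℝ≥0∞ :=
  (∑' k : ℕ, (∑' j : ℕ, ‖A (seqBasis 𝕜 p j) (seqBasis 𝕜 q k)‖ₑ ^ r) ^ (s / r)) ^ (1 / s)

/-- The exponent `λ = pq / (pq - p - q)`, written `1 / λ = 1 - 1 / p - 1 / q` so that it also makes
sense when `p = ∞` or `q = ∞` (with `1 / ∞ = 0`). -/
def hlExponent (p q : ℝ≥0∞) : ℝ :=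
  1 / (1 - (1 / p).toReal - (1 / q).toReal)

theorem hlExponent_of_finite {p q : ℝ} (hp : 0 < p) (hq : 0 < q) :
    hlExponent (ENNReal.ofReal p) (ENNReal.ofReal q) = p * q / (p * q - p - q) := by
  have h : 1 - 1 / p - 1 / q = (p * q - p - q) / (p * q) := by
    field_simp
    ring
  simp only [hlExponent, ENNReal.toReal_div, ENNReal.toReal_one,
    ENNReal.toReal_ofReal hp.le, ENNReal.toReal_ofReal hq.le, h, one_div_div]

end

/-! For (a), testing `A` on sign vectors and averaging with Khinchine's inequality gives mixed `(ℓ₁,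
ℓ₂)` bounds for the matrix and its transpose, with weights `t ^ (1 / p)` and `τ ^ (1 / q)` inserted
(`MatrixFormBound.sum_sqrt_le`). A Bennett–Carl interpolation (`sum_sqrt_rpow_le`) removes `t` and
improves `ℓ₁` to `ℓ_u`, `1 / u = 1 - 1 / p`; choosing `τ` as a power of the column norms then raises
`u` to `λ`. Writing unit-ball vectors through nonnegative weights treats `p = ∞` as exponent `0`,
with no separate case.

For (b) and (c), a form of norm at most `K` on `ℓ₂ⁿ × ℓ₂ⁿ` has norm at most `K * n ^ (1 / λ)` here
(`exists_bilinForm`). The identity has `K = 1` and mixed sum at least `n ^ (1 / s)`; a Hadamard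
matrix has `K = √n` and mixed sum at least `n ^ (1 / λ + 1 / r)`. -/

/-! ### Khinchine's inequality by moments. -/

section Khinchine

variable {𝕜 : Type*} [RCLike 𝕜]

/-- The signed sum `∑_{i < n} ± c i`, with sign `+` exactly for `i ∈ s`. -/
def signedSum (c : ℕ → 𝕜) (n : ℕ) (s : Finset ℕ) : 𝕜 :=
  ∑ i ∈ Finset.range n, (if i ∈ s then 1 else -1) * c i

theorem sum_signedSum_succ (c : ℕ → 𝕜) (n : ℕ) (F : 𝕜 → ℝ) :
    ∑ s ∈ (Finset.range (n + 1)).powerset, F (signedSum c (n + 1) s) =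
      ∑ s ∈ (Finset.range n).powerset,
        (F (signedSum c n s + c n) + F (signedSum c n s - c n)) := by
  rw [Finset.range_add_one, Finset.sum_powerset_insert Finset.notMem_range_self,
    ← Finset.sum_add_distrib]
  refine Finset.sum_congr rfl fun s hs => ?_
  have hn : n ∉ s := fun h => Finset.notMem_range_self (Finset.mem_powerset.1 hs h)
  have h1 : signedSum c (n + 1) s = signedSum c n s - c n := by
    simp [signedSum, Finset.sum_range_succ, hn, sub_eq_add_neg]
  have h2 : signedSum c (n + 1) (insert n s) = signedSum c n s + c n := by
    simp only [signedSum, Finset.sum_range_succ, Finset.mem_insert_self, if_true, one_mul]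
    congr 1
    refine Finset.sum_congr rfl fun i hi => ?_
    have : i ≠ n := (Finset.mem_range.1 hi).ne
    simp [this]
  rw [h1, h2, add_comm]

theorem norm_sq_add_sub (x c : 𝕜) : ‖x + c‖ ^ 2 + ‖x - c‖ ^ 2 = 2 * (‖x‖ ^ 2 + ‖c‖ ^ 2) := by
  have := parallelogram_law_with_norm 𝕜 x c
  simp only [sq]
  linarith

/-- The squared norms have sum given by the parallelogram law and difference at most `4 * ‖x‖ *
‖c‖`; sum and difference control the sum of their squares. -/
theorem norm_pow_four_add_sub_le (x c : 𝕜) :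
    ‖x + c‖ ^ 4 + ‖x - c‖ ^ 4 ≤ 2 * (‖x‖ ^ 4 + 6 * ‖c‖ ^ 2 * ‖x‖ ^ 2 + ‖c‖ ^ 4) := by
  have h := norm_sq_add_sub x c
  have a1 : ‖x + c‖ ^ 2 ≤ (‖x‖ + ‖c‖) ^ 2 := by gcongr; exact norm_add_le x c
  have a2 : ‖x - c‖ ^ 2 ≤ (‖x‖ + ‖c‖) ^ 2 := by gcongr; exact norm_sub_le x c
  have d : (‖x + c‖ ^ 2 - ‖x - c‖ ^ 2) ^ 2 ≤ (4 * (‖x‖ * ‖c‖)) ^ 2 :=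
    sq_le_sq' (by nlinarith) (by nlinarith)
  have e : (‖x + c‖ ^ 2 + ‖x - c‖ ^ 2) ^ 2 = (2 * (‖x‖ ^ 2 + ‖c‖ ^ 2)) ^ 2 := by rw [h]
  nlinarith

theorem sum_norm_signedSum_sq (c : ℕ → 𝕜) (n : ℕ) :
    ∑ s ∈ (Finset.range n).powerset, ‖signedSum c n s‖ ^ 2 =
      2 ^ n * ∑ i ∈ Finset.range n, ‖c i‖ ^ 2 := by
  induction n with
  | zero => simp [signedSum]
  | succ n ih =>
    rw [sum_signedSum_succ c n (fun z => ‖z‖ ^ 2)]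
    simp only [norm_sq_add_sub]
    rw [← Finset.mul_sum, Finset.sum_add_distrib, ih, Finset.sum_range_succ]
    simp only [Finset.sum_const, Finset.card_powerset, Finset.card_range, nsmul_eq_mul]
    push_cast
    ring

theorem sum_norm_signedSum_pow_four_le (c : ℕ → 𝕜) (n : ℕ) :
    ∑ s ∈ (Finset.range n).powerset, ‖signedSum c n s‖ ^ 4 ≤
      3 * 2 ^ n * (∑ i ∈ Finset.range n, ‖c i‖ ^ 2) ^ 2 := by
  induction n with
  | zero => simp [signedSum]
  | succ n ih =>
    rw [sum_signedSum_succ c n (fun z => ‖z‖ ^ 4)]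
    refine (Finset.sum_le_sum fun s _ => norm_pow_four_add_sub_le (signedSum c n s) (c n)).trans ?_
    rw [← Finset.mul_sum, Finset.sum_add_distrib, Finset.sum_add_distrib, ← Finset.mul_sum,
      sum_norm_signedSum_sq, Finset.sum_range_succ]
    simp only [Finset.sum_const, Finset.card_powerset, Finset.card_range, nsmul_eq_mul]
    push_cast
    have : (0 : ℝ) ≤ 2 ^ n * ‖c n‖ ^ 4 := by positivity
    rw [pow_succ (2 : ℝ) n]
    nlinarith

/-- Khinchine's inequality between the `L₁` and `L₂` norms of a Rademacher sum. -/
theorem khinchine_one (c : ℕ → 𝕜) (n : ℕ) :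
    2 ^ n * √(∑ i ∈ Finset.range n, ‖c i‖ ^ 2) ≤
      2 * ∑ s ∈ (Finset.range n).powerset, ‖signedSum c n s‖ := by
  set v := ∑ i ∈ Finset.range n, ‖c i‖ ^ 2 with hv
  have hv0 : 0 ≤ v := Finset.sum_nonneg fun i _ => by positivity
  obtain h0 | hpos := (Real.sqrt_nonneg v).eq_or_lt
  · rw [← h0, mul_zero]
    positivity
  set σ := √v with hσ
  have hσv : σ ^ 2 = v := Real.sq_sqrt hv0
  -- Summed over signs, this bounds the second moment by the first and fourth; the fourth-moment
  -- bound absorbs half of the left side.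
  have key : ∀ t : ℝ, 0 ≤ t → 6 * σ ^ 2 * t ^ 2 ≤ 6 * σ ^ 3 * t + t ^ 4 := by
    intro t ht
    -- The cubic `t ^ 3 - 6 σ² t + 4√2 σ³` has a double root at `√2 σ`, and `4√2 ≤ 6`.
    have : 0 ≤ t * ((t - √2 * σ) ^ 2 * (t + 2 * √2 * σ) + (6 - 4 * √2) * σ ^ 3) := by
      have h2 : √2 ≤ 1.5 := Real.sqrt_le_iff.2 (by norm_num)
      have : 0 ≤ 6 - 4 * √2 := by linarith
      positivity
    have h2 : √2 ^ 2 = 2 := Real.sq_sqrt (by norm_num)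
    have h3 : √2 ^ 3 = 2 * √2 := by rw [pow_succ, h2]
    have e : t * ((t - √2 * σ) ^ 2 * (t + 2 * √2 * σ) + (6 - 4 * √2) * σ ^ 3) =
      t ^ 4 - 3 * √2 ^ 2 * σ ^ 2 * t ^ 2 + 2 * √2 ^ 3 * σ ^ 3 * t + (6 - 4 * √2) * σ ^ 3 * t := by
      ring
    rw [e, h2, h3] at this
    linarith
  have h := Finset.sum_le_sum fun s (_ : s ∈ (Finset.range n).powerset) =>
    key ‖signedSum c n s‖ (norm_nonneg _)
  rw [Finset.sum_add_distrib, ← Finset.mul_sum, ← Finset.mul_sum, sum_norm_signedSum_sq] at h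
  have h4 := sum_norm_signedSum_pow_four_le c n
  rw [← hv, ← hσv] at h h4
  refine le_of_mul_le_mul_left ?_ (pow_pos hpos 3)
  nlinarith

end Khinchine

/-! ### Interpolation between mixed norms. -/

/-- Hölder's inequality with exponents `1 / θ` and `1 / η`, degenerate cases included. -/
theorem sum_rpow_mul_rpow_le {ι : Type*} (s : Finset ι) (f g : ι → ℝ) (hf : ∀ i, 0 ≤ f i)
    (hg : ∀ i, 0 ≤ g i) {θ η : ℝ} (hθ : 0 ≤ θ) (hη : 0 ≤ η) (h : θ + η = 1) :
    ∑ i ∈ s, f i ^ θ * g i ^ η ≤ (∑ i ∈ s, f i) ^ θ * (∑ i ∈ s, g i) ^ η := by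
  obtain rfl | hθ := hθ.eq_or_lt
  · obtain rfl : η = 1 := by linarith
    simp
  obtain rfl | hη := hη.eq_or_lt
  · obtain rfl : θ = 1 := by linarith
    simp
  have hc : Real.HolderConjugate θ⁻¹ η⁻¹ :=
    ⟨by simpa using h, inv_pos.2 hθ, inv_pos.2 hη⟩
  have := Real.inner_le_Lp_mul_Lq_of_nonneg s (f := fun i => f i ^ θ) (g := fun i => g i ^ η) hc
    (fun i _ => Real.rpow_nonneg (hf i) _) (fun i _ => Real.rpow_nonneg (hg i) _)
  simpa only [one_div, inv_inv, Real.rpow_rpow_inv (hf _) hθ.ne',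
    Real.rpow_rpow_inv (hg _) hη.ne'] using this

theorem le_rpow_of_le_mul_rpow {S K P : ℝ} (hS : 0 ≤ S) (hK : 0 ≤ K) (hP : P < 1)
    (h : S ≤ K * S ^ P) : S ≤ K ^ (1 / (1 - P)) := by
  have hP' : 0 < 1 - P := by linarith
  obtain rfl | hS := hS.eq_or_lt
  · positivity
  have h1 : S ^ (1 - P) ≤ K := by
    rw [Real.rpow_sub hS, Real.rpow_one, div_le_iff₀ (by positivity)]
    exact h
  calc S = (S ^ (1 - P)) ^ (1 / (1 - P)) := by
        rw [← Real.rpow_mul hS.le, mul_one_div_cancel hP'.ne', Real.rpow_one]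
    _ ≤ _ := by gcongr

/-- The Bennett–Carl argument: weighted mixed `(ℓ₁, ℓ₂)` estimates for a nonnegative matrix and its
transpose give an `(ℓ_u, ℓ₂)` estimate, where `1 / u = 1 - P`. -/
theorem sum_sqrt_rpow_le (n m : ℕ) (c : ℕ → ℕ → ℝ) (hc : ∀ j k, 0 ≤ c j k) {P K : ℝ}
    (hP0 : 0 ≤ P) (hP : P ≤ 1 / 2) (hK : 0 ≤ K)
    (h1 : ∀ t : ℕ → ℝ, (∀ j, 0 ≤ t j) →
      ∑ k ∈ Finset.range m, √(∑ j ∈ Finset.range n, (t j ^ P * c j k) ^ 2) ≤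
        K * (∑ j ∈ Finset.range n, t j) ^ P)
    (h2 : ∀ t : ℕ → ℝ, (∀ j, 0 ≤ t j) →
      ∑ j ∈ Finset.range n, t j ^ P * √(∑ k ∈ Finset.range m, c j k ^ 2) ≤
        K * (∑ j ∈ Finset.range n, t j) ^ P) :
    ∑ k ∈ Finset.range m, √(∑ j ∈ Finset.range n, c j k ^ 2) ^ (1 / (1 - P)) ≤
      K ^ (1 / (1 - P)) := by
  have hP' : 0 < 1 - P := by linarith
  set u := 1 / (1 - P) with hu
  have hu0 : 0 < u := by positivity
  have hPu : P * u = u - 1 := by rw [hu]; field_simp; ring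
  have hu1 : 1 ≤ u := by nlinarith
  have hu2 : u ≤ 2 := by nlinarith
  set s : ℕ → ℝ := fun j => √(∑ k ∈ Finset.range m, c j k ^ 2) with hs
  have hs0 : ∀ j, 0 ≤ s j := fun j => Real.sqrt_nonneg _
  have hsP : ∀ j, (s j ^ u) ^ P = s j ^ (u - 1) := fun j => by
    rw [← Real.rpow_mul (hs0 j), mul_comm, hPu]
  have hsu : ∀ j, s j ^ (u - 1) * s j = s j ^ u := fun j => by
    rw [← Real.rpow_add_one' (hs0 j) (by linarith)]; ring_nf
  have hsu0 : ∀ j, 0 ≤ s j ^ u := fun j => Real.rpow_nonneg (hs0 j) _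
  set S := ∑ j ∈ Finset.range n, s j ^ u with hS
  have hS0 : 0 ≤ S := Finset.sum_nonneg fun j _ => hsu0 j
  -- With `t = s ^ u` the weight is `s ^ (u - 1)`, so the left side of `h2` is `S` itself and `S ^
  -- P` can be absorbed.
  have hSK : S ≤ K ^ u := by
    refine le_rpow_of_le_mul_rpow hS0 hK (by linarith) ?_
    have := h2 (fun j => s j ^ u) hsu0
    simp only [hsP] at this
    exact (Finset.sum_congr rfl fun j _ => (hsu j).symm).le.trans this
  have hSP : K * S ^ P ≤ K ^ u := by
    calc K * S ^ P ≤ K * (K ^ u) ^ P := by gcongr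
      _ = K ^ u := by
        rw [← Real.rpow_mul hK, mul_comm u, hPu, mul_comm, ← Real.rpow_add_one' hK (by linarith)]
        ring_nf
  set D : ℕ → ℝ := fun k => √(∑ j ∈ Finset.range n, (s j ^ (u - 1) * c j k) ^ 2) with hD
  have hD0 : ∀ k, 0 ≤ D k := fun k => Real.sqrt_nonneg _
  have hDK : ∑ k ∈ Finset.range m, D k ≤ K ^ u := by
    have := h1 (fun j => s j ^ u) hsu0
    simp only [hsP] at this
    exact this.trans hSP
  -- The weight `s ^ (u - 2)` on `c²` makes the sum over both indices collapse to `S`.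
  set E : ℕ → ℝ := fun k => ∑ j ∈ Finset.range n, (s j ^ (u / 2 - 1) * c j k) ^ 2 with hE
  have hE0 : ∀ k, 0 ≤ E k := fun k => Finset.sum_nonneg fun j _ => sq_nonneg _
  have hEK : ∑ k ∈ Finset.range m, E k ≤ K ^ u := by
    refine le_trans ?_ hSK
    rw [hE, Finset.sum_comm]
    refine Finset.sum_le_sum fun j _ => ?_
    simp only [mul_pow]
    rw [← Finset.mul_sum, ← Real.sq_sqrt (Finset.sum_nonneg fun k _ => sq_nonneg (c j k))]
    change (s j ^ (u / 2 - 1)) ^ 2 * s j ^ 2 ≤ s j ^ u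
    obtain h0 | h0 := (hs0 j).eq_or_lt
    · rw [← h0]
      simp [Real.zero_rpow hu0.ne']
    · rw [← mul_pow, ← Real.rpow_add_one h0.ne', ← Real.rpow_natCast, ← Real.rpow_mul h0.le]
      apply le_of_eq
      congr 1
      push_cast
      ring
  have hθ : 0 ≤ (2 - u) / u := div_nonneg (by linarith) hu0.le
  have hη : 0 ≤ (2 * u - 2) / u := div_nonneg (by linarith) hu0.le
  have hθη : (2 - u) / u + (2 * u - 2) / u = 1 := by field_simp; ring
  -- Hölder between `D` and `E`: the exponents are those for which the powers of `s j` cancel.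
  have hB : ∀ k ∈ Finset.range m, √(∑ j ∈ Finset.range n, c j k ^ 2) ^ u ≤ D k ^ (2 - u) * E k ^ (u - 1) := by
    intro k hk
    have hle : ∑ j ∈ Finset.range n, c j k ^ 2 ≤
        (D k ^ 2) ^ ((2 - u) / u) * E k ^ ((2 * u - 2) / u) := by
      rw [hD, Real.sq_sqrt (Finset.sum_nonneg fun j _ => sq_nonneg _)]
      refine le_trans (Finset.sum_le_sum fun j _ => ?_) (sum_rpow_mul_rpow_le _ _ _
        (fun j => sq_nonneg _) (fun j => sq_nonneg _) hθ hη hθη)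
      obtain h0 | h0 := (hc j k).eq_or_lt
      · rw [← h0]
        simp only [ne_eq, OfNat.ofNat_ne_zero, not_false_eq_true, zero_pow, mul_zero]
        positivity
      -- A nonzero entry forces a nonzero row, so powers of `s j` may be combined freely.
      have hsj : 0 < s j := by
        refine Real.sqrt_pos.2 (lt_of_lt_of_le (pow_pos h0 2) ?_)
        exact Finset.single_le_sum (f := fun k => c j k ^ 2) (fun i _ => sq_nonneg _) hk
      have e : ∀ a b : ℝ, ((s j ^ a * c j k) ^ 2) ^ b = s j ^ (2 * a * b) * (c j k ^ 2) ^ b := by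
        intro a b
        rw [mul_pow, Real.mul_rpow (by positivity) (by positivity), ← Real.rpow_mul_natCast hsj.le,
          ← Real.rpow_mul hsj.le]
        ring_nf
      rw [e, e, mul_mul_mul_comm, ← Real.rpow_add hsj, ← Real.rpow_add (pow_pos h0 2), hθη,
        Real.rpow_one]
      have : 2 * (u - 1) * ((2 - u) / u) + 2 * (u / 2 - 1) * ((2 * u - 2) / u) = 0 := by
        field_simp
        ring
      rw [this, Real.rpow_zero, one_mul]
    rw [Real.sqrt_eq_rpow, ← Real.rpow_mul (Finset.sum_nonneg fun j _ => sq_nonneg _)]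
    calc _ ≤ ((D k ^ 2) ^ ((2 - u) / u) * E k ^ ((2 * u - 2) / u)) ^ (1 / 2 * u) :=
          Real.rpow_le_rpow (Finset.sum_nonneg fun j _ => sq_nonneg _) hle (by positivity)
      _ = _ := by
          rw [Real.mul_rpow (by positivity) (Real.rpow_nonneg (hE0 k) _),
            ← Real.rpow_natCast_mul (hD0 k), ← Real.rpow_mul (hD0 k), ← Real.rpow_mul (hE0 k)]
          congr 2 <;> (push_cast; field_simp)
  calc _ ≤ ∑ k ∈ Finset.range m, D k ^ (2 - u) * E k ^ (u - 1) :=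
        Finset.sum_le_sum fun k hk => hB k hk
    _ ≤ (∑ k ∈ Finset.range m, D k) ^ (2 - u) * (∑ k ∈ Finset.range m, E k) ^ (u - 1) :=
        sum_rpow_mul_rpow_le _ _ _ hD0 hE0 (by linarith) (by linarith) (by ring)
    _ ≤ (K ^ u) ^ (2 - u) * (K ^ u) ^ (u - 1) := by
        have := Finset.sum_nonneg fun k (_ : k ∈ Finset.range m) => hD0 k
        have := Finset.sum_nonneg fun k (_ : k ∈ Finset.range m) => hE0 k
        have : 0 ≤ 2 - u := by linarith
        have : 0 ≤ u - 1 := by linarith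
        gcongr
    _ = K ^ u := by
        rw [← Real.rpow_add' (by positivity) (by norm_num)]
        norm_num

/-! ### The inequality for finite matrices. -/

section Matrix

variable {𝕜 : Type*} [RCLike 𝕜]

/-- The bilinear form with matrix `a`, restricted to the first `n × m` coordinates, has norm at most
`M` on `ℓ_p × ℓ_q`, where `P = 1 / p` and `Q = 1 / q`. -/
def MatrixFormBound (a : ℕ → ℕ → 𝕜) (n m : ℕ) (P Q M : ℝ) : Prop :=
  ∀ (x y : ℕ → 𝕜) (t τ : ℕ → ℝ), (∀ j, 0 ≤ t j) → (∀ k, 0 ≤ τ k) →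
    (∀ j, ‖x j‖ ≤ t j ^ P) → (∀ k, ‖y k‖ ≤ τ k ^ Q) →
    ‖∑ j ∈ Finset.range n, ∑ k ∈ Finset.range m, x j * y k * a j k‖ ≤
      M * (∑ j ∈ Finset.range n, t j) ^ P * (∑ k ∈ Finset.range m, τ k) ^ Q

theorem MatrixFormBound.transpose {a : ℕ → ℕ → 𝕜} {n m : ℕ} {P Q M : ℝ}
    (h : MatrixFormBound a n m P Q M) : MatrixFormBound (fun k j => a j k) m n Q P M := by
  intro y x τ t hτ ht hy hx
  have := h x y t τ ht hτ hx hy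
  rw [Finset.sum_comm, mul_right_comm] at this
  simpa only [mul_comm (x _)] using this

theorem exists_norm_le_one_mul_eq_norm (z : 𝕜) : ∃ w : 𝕜, ‖w‖ ≤ 1 ∧ w * z = (‖z‖ : 𝕜) := by
  obtain rfl | hz := eq_or_ne z 0
  · exact ⟨0, by simp⟩
  · have hz' : (‖z‖ : 𝕜) ≠ 0 := by simpa using hz
    refine ⟨(starRingEnd 𝕜) z / (‖z‖ : 𝕜), ?_, ?_⟩
    · rw [norm_div, RCLike.norm_conj, RCLike.norm_coe_norm, div_self (norm_ne_zero_iff.2 hz)]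
    · rw [div_mul_eq_mul_div, RCLike.conj_mul, sq, mul_div_assoc, div_self hz', mul_one]

/-- Test the form on `± t ^ P` and on `τ ^ Q` times the phases that make every column sum
nonnegative. -/
theorem MatrixFormBound.sum_norm_signedSum_le {a : ℕ → ℕ → 𝕜} {n m : ℕ} {P Q M : ℝ}
    (h : MatrixFormBound a n m P Q M) {t τ : ℕ → ℝ} (ht : ∀ j, 0 ≤ t j) (hτ : ∀ k, 0 ≤ τ k)
    (s : Finset ℕ) :
    ∑ k ∈ Finset.range m, ‖signedSum (fun j => ((t j ^ P * τ k ^ Q : ℝ) : 𝕜) * a j k) n s‖ ≤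
      M * (∑ j ∈ Finset.range n, t j) ^ P * (∑ k ∈ Finset.range m, τ k) ^ Q := by
  choose w hw hw' using fun k => exists_norm_le_one_mul_eq_norm
    (signedSum (fun j => ((t j ^ P * τ k ^ Q : ℝ) : 𝕜) * a j k) n s)
  have htP : ∀ j, 0 ≤ t j ^ P := fun j => Real.rpow_nonneg (ht j) _
  have hτQ : ∀ k, 0 ≤ τ k ^ Q := fun k => Real.rpow_nonneg (hτ k) _
  have hb := h (fun j => (if j ∈ s then 1 else -1) * ((t j ^ P : ℝ) : 𝕜))
    (fun k => w k * ((τ k ^ Q : ℝ) : 𝕜)) t τ ht hτ ?_ ?_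
  · refine le_trans (le_of_eq ?_) hb
    rw [Finset.sum_comm]
    have e : ∀ k, ∑ j ∈ Finset.range n, (if j ∈ s then 1 else -1) * ((t j ^ P : ℝ) : 𝕜) *
        (w k * ((τ k ^ Q : ℝ) : 𝕜)) * a j k =
        (‖signedSum (fun j => ((t j ^ P * τ k ^ Q : ℝ) : 𝕜) * a j k) n s‖ : 𝕜) := by
      intro k
      rw [← hw', signedSum, Finset.mul_sum]
      refine Finset.sum_congr rfl fun j _ => ?_
      push_cast
      ring
    simp only [e]
    rw [← map_sum, RCLike.norm_ofReal, abs_of_nonneg (Finset.sum_nonneg fun k _ => norm_nonneg _)]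
  · intro j
    rw [norm_mul, RCLike.norm_ofReal, abs_of_nonneg (htP j)]
    split_ifs <;> simp
  · intro k
    rw [norm_mul, RCLike.norm_ofReal, abs_of_nonneg (hτQ k)]
    exact mul_le_of_le_one_left (hτQ k) (hw k)

/-- A weighted Littlewood mixed `(ℓ₁, ℓ₂)` inequality. -/
theorem MatrixFormBound.sum_sqrt_le {a : ℕ → ℕ → 𝕜} {n m : ℕ} {P Q M : ℝ}
    (h : MatrixFormBound a n m P Q M) {t τ : ℕ → ℝ} (ht : ∀ j, 0 ≤ t j) (hτ : ∀ k, 0 ≤ τ k) :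
    ∑ k ∈ Finset.range m, √(∑ j ∈ Finset.range n, (t j ^ P * (τ k ^ Q * ‖a j k‖)) ^ 2) ≤
      2 * M * (∑ j ∈ Finset.range n, t j) ^ P * (∑ k ∈ Finset.range m, τ k) ^ Q := by
  have htP : ∀ j, 0 ≤ t j ^ P := fun j => Real.rpow_nonneg (ht j) _
  have hτQ : ∀ k, 0 ≤ τ k ^ Q := fun k => Real.rpow_nonneg (hτ k) _
  have h2 : (0 : ℝ) < 2 ^ n := by positivity
  refine le_of_mul_le_mul_left ?_ h2
  rw [Finset.mul_sum]
  calc _ ≤ ∑ k ∈ Finset.range m, 2 * ∑ s ∈ (Finset.range n).powerset,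
        ‖signedSum (fun j => ((t j ^ P * τ k ^ Q : ℝ) : 𝕜) * a j k) n s‖ := by
        refine Finset.sum_le_sum fun k _ => le_trans (le_of_eq ?_) (khinchine_one _ n)
        simp only [norm_mul, RCLike.norm_ofReal, abs_of_nonneg (mul_nonneg (htP _) (hτQ k)),
          mul_assoc]
    _ = 2 * ∑ s ∈ (Finset.range n).powerset, ∑ k ∈ Finset.range m,
        ‖signedSum (fun j => ((t j ^ P * τ k ^ Q : ℝ) : 𝕜) * a j k) n s‖ := by
        rw [← Finset.mul_sum, Finset.sum_comm]
    _ ≤ 2 * ∑ s ∈ (Finset.range n).powerset,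
        M * (∑ j ∈ Finset.range n, t j) ^ P * (∑ k ∈ Finset.range m, τ k) ^ Q := by
        gcongr
        exact h.sum_norm_signedSum_le ht hτ _
    _ = _ := by
        simp only [Finset.sum_const, Finset.card_powerset, Finset.card_range, nsmul_eq_mul]
        push_cast
        ring

/-- The Hardy–Littlewood inequality for finite matrices. -/
theorem MatrixFormBound.sum_sqrt_rpow_le {a : ℕ → ℕ → 𝕜} {n m : ℕ} {P Q M : ℝ}
    (h : MatrixFormBound a n m P Q M) (hM : 0 ≤ M) (hP0 : 0 ≤ P) (hP : P ≤ 1 / 2)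
    (hPQ : P + Q < 1) :
    ∑ k ∈ Finset.range m, √(∑ j ∈ Finset.range n, ‖a j k‖ ^ 2) ^ (1 / (1 - P - Q)) ≤
      (2 * M) ^ (1 / (1 - P - Q)) := by
  have hP' : 0 < 1 - P := by linarith
  have hd : 0 < 1 - P - Q := by linarith
  set B : ℕ → ℝ := fun k => √(∑ j ∈ Finset.range n, ‖a j k‖ ^ 2) with hB
  have hB0 : ∀ k, 0 ≤ B k := fun k => Real.sqrt_nonneg _
  set lam := 1 / (1 - P - Q) with hlam
  have hl : 0 < lam := by positivity
  set u := 1 / (1 - P) with hu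
  have hu0 : 0 < u := by positivity
  -- Since `(λ Q + 1) u = λ`, the weighted column norm `τ k ^ Q * B k` to the power `u` is `B k ^
  -- λ`, so the estimate bounds `R` by a power of itself.
  set τ : ℕ → ℝ := fun k => B k ^ lam
  have hτ : ∀ k, 0 ≤ τ k := fun k => Real.rpow_nonneg (hB0 k) _
  have hτQ : ∀ k, 0 ≤ τ k ^ Q := fun k => Real.rpow_nonneg (hτ k) _
  set R := ∑ k ∈ Finset.range m, τ k
  have hR0 : 0 ≤ R := Finset.sum_nonneg fun k _ => hτ k
  have hRQ : 0 ≤ R ^ Q := Real.rpow_nonneg hR0 _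
  have key := _root_.sum_sqrt_rpow_le n m (fun j k => τ k ^ Q * ‖a j k‖)
    (fun j k => mul_nonneg (hτQ k) (norm_nonneg _)) hP0 hP (K := 2 * M * R ^ Q) (by positivity)
    (fun t ht => (h.sum_sqrt_le ht hτ).trans_eq (by ring)) (fun t ht => by
      refine le_trans (le_of_eq ?_) (h.transpose.sum_sqrt_le hτ ht)
      refine Finset.sum_congr rfl fun j _ => ?_
      have htP : 0 ≤ t j ^ P := Real.rpow_nonneg (ht j) _
      rw [← Real.sqrt_sq htP, ← Real.sqrt_mul (sq_nonneg _), Real.sqrt_sq htP, Finset.mul_sum]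
      congr 1
      refine Finset.sum_congr rfl fun k _ => ?_
      ring)
  have hexp : lam * Q * u + u = lam := by
    rw [hlam, hu]
    field_simp
    ring
  have hsum : R ≤ (2 * M) ^ u * R ^ (Q * u) := by
    rw [Real.rpow_mul hR0, ← Real.mul_rpow (by positivity) hRQ]
    refine le_trans (le_of_eq (Finset.sum_congr rfl fun k _ => ?_)) key
    simp only [mul_pow]
    rw [← Finset.mul_sum, Real.sqrt_mul (sq_nonneg _), Real.sqrt_sq (hτQ k),
      Real.mul_rpow (hτQ k) (hB0 k), ← Real.rpow_mul (hτ k), ← Real.rpow_mul (hB0 k),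
      ← Real.rpow_add' (hB0 k) (by rw [← mul_assoc, hexp]; exact hl.ne'), ← mul_assoc, hexp]
  have hQu : 1 - Q * u = u / lam := by
    rw [hlam, hu]
    field_simp
  have hQu1 : Q * u < 1 := by
    have : 0 < u / lam := by positivity
    linarith
  -- Absorbing `R ^ (Q * u)` with `Q * u < 1` turns the exponent `u` of `2 * M` into `λ`.
  have := le_rpow_of_le_mul_rpow hR0 (by positivity) hQu1 hsum
  rwa [← Real.rpow_mul (by positivity), hQu, one_div_div, mul_div_cancel₀ _ hu0.ne'] at this

end Matrix

/-! ### Finite sections of `ℓ_p` and `c₀`. -/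

section SequenceSpaces

variable {𝕜 : Type*} [RCLike 𝕜] {p q : ℝ≥0∞}

theorem toReal_one_div_le_half (hp : 2 ≤ p) : (1 / p).toReal ≤ 1 / 2 := by
  have : 1 / p ≤ 1 / 2 := by gcongr
  have h := ENNReal.toReal_mono (by simp) this
  simpa using h

theorem toReal_one_div_add_lt_one (hp : 2 ≤ p) (hq : 2 ≤ q) (hpq : 1 / p + 1 / q < 1) :
    (1 / p).toReal + (1 / q).toReal < 1 := by
  have hp' : 1 / p ≠ ∞ := by
    simpa using (lt_of_lt_of_le (by norm_num) hp).ne'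
  have hq' : 1 / q ≠ ∞ := by
    simpa using (lt_of_lt_of_le (by norm_num) hq).ne'
  rw [← ENNReal.toReal_add hp' hq']
  simpa using (ENNReal.toReal_lt_toReal (ENNReal.add_ne_top.2 ⟨hp', hq'⟩) (by simp)).2 hpq

theorem hlExponent_pos (hp : 2 ≤ p) (hq : 2 ≤ q) (hpq : 1 / p + 1 / q < 1) :
    0 < hlExponent p q := by
  have := toReal_one_div_add_lt_one hp hq hpq
  exact one_div_pos.2 (by linarith)

theorem seqBasis_apply (i j : ℕ) :
    (seqBasis 𝕜 p j).1 i = if i = j then 1 else 0 := by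
  simp [seqBasis, lp.single_apply, Pi.single_apply]

theorem coe_sum_smul_seqBasis_apply (x : ℕ → 𝕜) (n i : ℕ) :
    (∑ j ∈ Finset.range n, x j • seqBasis 𝕜 p j).1 i = if i < n then x i else 0 := by
  rw [AddSubmonoidClass.coe_finsetSum, lp.coeFn_sum, Finset.sum_apply]
  have : ∀ j, ((x j • seqBasis 𝕜 p j : seqSpace 𝕜 p) : lp (fun _ : ℕ => 𝕜) p) i =
      if i = j then x j else 0 := by
    intro j
    rw [Submodule.coe_smul, lp.coeFn_smul, Pi.smul_apply, seqBasis_apply]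
    simp
  simp only [this]
  simp

variable [Fact (1 ≤ p)] [Fact (1 ≤ q)]

theorem norm_sum_smul_seqBasis_le (n : ℕ) {x : ℕ → 𝕜} {t : ℕ → ℝ} (ht : ∀ j, 0 ≤ t j)
    (hx : ∀ j, ‖x j‖ ≤ t j ^ (1 / p).toReal) :
    ‖∑ j ∈ Finset.range n, x j • seqBasis 𝕜 p j‖ ≤
      (∑ j ∈ Finset.range n, t j) ^ (1 / p).toReal := by
  have hS : 0 ≤ ∑ j ∈ Finset.range n, t j := Finset.sum_nonneg fun j _ => ht j
  rw [Submodule.coe_norm]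
  obtain rfl | hp := eq_or_ne p ∞
  · refine lp.norm_le_of_forall_le (by positivity) fun i => ?_
    rw [coe_sum_smul_seqBasis_apply]
    have := hx i
    split_ifs <;> simp_all
  · have hp0 : 0 < p.toReal :=
      ENNReal.toReal_pos (zero_lt_one.trans_le (Fact.out : 1 ≤ p)).ne' hp
    have hinv : (1 / p).toReal * p.toReal = 1 := by
      rw [ENNReal.toReal_div, ENNReal.toReal_one, one_div_mul_cancel hp0.ne']
    refine lp.norm_le_of_forall_sum_le hp0 (by positivity) fun s => ?_
    rw [← Real.rpow_mul hS, hinv, Real.rpow_one]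
    calc _ ≤ ∑ i ∈ s, if i < n then t i else 0 := by
          refine Finset.sum_le_sum fun i _ => ?_
          rw [coe_sum_smul_seqBasis_apply]
          split_ifs
          · calc ‖x i‖ ^ p.toReal ≤ (t i ^ (1 / p).toReal) ^ p.toReal := by gcongr; exact hx i
              _ = t i := by rw [← Real.rpow_mul (ht i), hinv, Real.rpow_one]
          · simp [hp0.ne']
      _ ≤ _ := by
          rw [← Finset.sum_filter]
          refine Finset.sum_le_sum_of_subset_of_nonneg (fun i hi => ?_) fun i _ _ => ht i
          simpa using (Finset.mem_filter.1 hi).2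

/-- Power means compare the `ℓ₂` and `ℓ_p` norms on `n` coordinates; the two such factors for `p`
and `q` multiply to `n ^ (1 / λ)`. -/
theorem sqrt_sum_norm_sq_le (hp : 2 ≤ p) {n : ℕ} (hn : 0 < n) (x : seqSpace 𝕜 p) :
    √(∑ j ∈ Finset.range n, ‖x.1 j‖ ^ 2) ≤ (n : ℝ) ^ (1 / 2 - (1 / p).toReal) * ‖x‖ := by
  have hn' : (0 : ℝ) < n := by exact_mod_cast hn
  have hS : 0 ≤ ∑ j ∈ Finset.range n, ‖x.1 j‖ ^ 2 := Finset.sum_nonneg fun j _ => sq_nonneg _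
  rw [Submodule.coe_norm]
  obtain rfl | hp' := eq_or_ne p ∞
  · have h : ∑ j ∈ Finset.range n, ‖x.1 j‖ ^ 2 ≤ n * ‖x.1‖ ^ 2 := by
      refine (Finset.sum_le_sum fun j _ => pow_le_pow_left₀ (norm_nonneg _)
        (lp.norm_apply_le_norm (by simp) x.1 j) 2).trans_eq (by simp)
    refine (Real.sqrt_le_sqrt h).trans_eq ?_
    rw [Real.sqrt_mul hn'.le, Real.sqrt_sq (norm_nonneg _), Real.sqrt_eq_rpow]
    simp
  · have hp2 : 2 ≤ p.toReal := by
      simpa using ENNReal.toReal_mono hp' hp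
    set r := p.toReal with hr
    have hr0 : 0 < r := by linarith
    have h1 := Real.rpow_arith_mean_le_arith_mean_rpow (Finset.range n) (fun _ => (n : ℝ)⁻¹)
      (fun j => ‖x.1 j‖ ^ 2) (fun _ _ => by positivity) (by simp [hn'.ne'])
      (fun _ _ => by positivity) (p := r / 2) (by linarith)
    rw [← Finset.mul_sum, ← Finset.mul_sum] at h1
    have h2 : ∑ j ∈ Finset.range n, (‖x.1 j‖ ^ 2) ^ (r / 2) ≤ ‖x.1‖ ^ r := by
      refine le_trans (le_of_eq (Finset.sum_congr rfl fun j _ => ?_))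
        (lp.sum_rpow_le_norm_rpow hr0 x.1 (Finset.range n))
      rw [← Real.rpow_natCast_mul (norm_nonneg _)]
      congr 1
      push_cast
      ring
    have h3 : ((n : ℝ)⁻¹ * ∑ j ∈ Finset.range n, ‖x.1 j‖ ^ 2) ^ (r / 2) ≤
        (n : ℝ)⁻¹ * ‖x.1‖ ^ r := h1.trans (by gcongr)
    have h4 := Real.rpow_le_rpow (by positivity) h3 (z := 1 / r) (by positivity)
    rw [← Real.rpow_mul (by positivity), Real.mul_rpow (by positivity) (by positivity),
      Real.mul_rpow (by positivity) (by positivity), ← Real.rpow_mul (norm_nonneg _),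
      show r / 2 * (1 / r) = 1 / 2 by field_simp, mul_one_div_cancel hr0.ne', Real.rpow_one,
      ← Real.sqrt_eq_rpow (∑ j ∈ Finset.range n, ‖x.1 j‖ ^ 2), Real.inv_rpow hn'.le,
      Real.inv_rpow hn'.le, inv_mul_le_iff₀ (by positivity), ← mul_assoc, ← Real.rpow_neg hn'.le,
      ← Real.rpow_add hn', ← sub_eq_add_neg] at h4
    rwa [ENNReal.toReal_div, ENNReal.toReal_one]

/-- A finite matrix with `ℓ₂`-norm at most `K` defines a bilinear form on `ℓ_p × ℓ_q`. -/
theorem exists_bilinForm (hp : 2 ≤ p) (hq : 2 ≤ q) {n : ℕ} (hn : 0 < n) (a : ℕ → ℕ → 𝕜) {K : ℝ}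
    (hK : 0 ≤ K)
    (ha : ∀ x y : ℕ → 𝕜, ‖∑ j ∈ Finset.range n, ∑ k ∈ Finset.range n, x j * y k * a j k‖ ≤
      K * √(∑ j ∈ Finset.range n, ‖x j‖ ^ 2) * √(∑ k ∈ Finset.range n, ‖y k‖ ^ 2)) :
    ∃ A : BilinForms 𝕜 p q, ‖A‖ ≤ K * (n : ℝ) ^ (1 / hlExponent p q) ∧
      ∀ j < n, ∀ k < n, A (seqBasis 𝕜 p j) (seqBasis 𝕜 q k) = a j k := by
  have hn' : (0 : ℝ) < n := by exact_mod_cast hn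
  let f : seqSpace 𝕜 p →ₗ[𝕜] seqSpace 𝕜 q →ₗ[𝕜] 𝕜 := LinearMap.mk₂ 𝕜
    (fun x y => ∑ j ∈ Finset.range n, ∑ k ∈ Finset.range n, x.1 j * y.1 k * a j k)
    (fun x x' y => by simp [add_mul, Finset.sum_add_distrib])
    (fun c x y => by simp [Finset.mul_sum, mul_assoc])
    (fun x y y' => by simp [add_mul, mul_add, Finset.sum_add_distrib])
    (fun c x y => by simp [Finset.mul_sum, mul_assoc, mul_left_comm])
  have hf : ∀ x y, ‖f x y‖ ≤ K * (n : ℝ) ^ (1 / hlExponent p q) * ‖x‖ * ‖y‖ := by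
    intro x y
    refine (ha (fun j => x.1 j) fun k => y.1 k).trans ?_
    have hx := sqrt_sum_norm_sq_le hp hn x
    have hy := sqrt_sum_norm_sq_le hq hn y
    calc _ ≤ K * ((n : ℝ) ^ (1 / 2 - (1 / p).toReal) * ‖x‖) *
          ((n : ℝ) ^ (1 / 2 - (1 / q).toReal) * ‖y‖) := by gcongr
      _ = K * ((n : ℝ) ^ (1 / 2 - (1 / p).toReal) * (n : ℝ) ^ (1 / 2 - (1 / q).toReal)) *
          ‖x‖ * ‖y‖ := by ring
      _ = _ := by
          rw [← Real.rpow_add hn', hlExponent, one_div_one_div]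
          ring_nf
  refine ⟨f.mkContinuous₂ _ hf, f.mkContinuous₂_norm_le (by positivity) hf, fun j hj k hk => ?_⟩
  rw [LinearMap.mkContinuous₂_apply]
  simp [f, seqBasis_apply, hj, hk]

end SequenceSpaces

/-! ### Sylvester's Hadamard matrices. -/

section Hadamard

/-- Sign matrices of size `2 ^ m` which are `√(2 ^ m)` times an isometry. -/
theorem exists_hadamard (𝕜 : Type*) [RCLike 𝕜] (m : ℕ) : ∃ H : ℕ → ℕ → 𝕜, (∀ j k, ‖H j k‖ = 1) ∧
    ∀ x : ℕ → 𝕜, ∑ k ∈ Finset.range (2 ^ m), ‖∑ j ∈ Finset.range (2 ^ m), x j * H j k‖ ^ 2 =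
      2 ^ m * ∑ j ∈ Finset.range (2 ^ m), ‖x j‖ ^ 2 := by
  induction m with
  | zero => exact ⟨fun _ _ => 1, by simp, by simp⟩
  | succ m ih =>
    obtain ⟨H, h1, h2⟩ := ih
    set N := 2 ^ m with hN
    -- Sylvester doubling: blocks `H, H, H, -H`. The parallelogram law adds the two column halves.
    refine ⟨fun j k => (if N ≤ j ∧ N ≤ k then -1 else 1) *
      H (if j < N then j else j - N) (if k < N then k else k - N), ?_, ?_⟩
    · intro j k
      rw [norm_mul, h1]
      split_ifs <;> simp
    · intro x
      have e1 : ∀ k ∈ Finset.range N, ∑ j ∈ Finset.range (N + N),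
          x j * ((if N ≤ j ∧ N ≤ k then -1 else 1) *
            H (if j < N then j else j - N) (if k < N then k else k - N)) =
          (∑ j ∈ Finset.range N, x j * H j k) + ∑ j ∈ Finset.range N, x (N + j) * H j k := by
        intro k hk
        have hk := Finset.mem_range.1 hk
        rw [Finset.sum_range_add]
        congr 1
        · refine Finset.sum_congr rfl fun j hj => ?_
          simp [hk, Finset.mem_range.1 hj, not_le.2 hk]
        · refine Finset.sum_congr rfl fun j _ => ?_
          simp [hk, not_le.2 hk]
      have e2 : ∀ k ∈ Finset.range N, ∑ j ∈ Finset.range (N + N),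
          x j * ((if N ≤ j ∧ N ≤ N + k then -1 else 1) *
            H (if j < N then j else j - N) (if N + k < N then N + k else N + k - N)) =
          (∑ j ∈ Finset.range N, x j * H j k) - ∑ j ∈ Finset.range N, x (N + j) * H j k := by
        intro k _
        rw [Finset.sum_range_add, sub_eq_add_neg, ← Finset.sum_neg_distrib]
        congr 1
        · refine Finset.sum_congr rfl fun j hj => ?_
          simp [Finset.mem_range.1 hj, not_le.2 (Finset.mem_range.1 hj)]
        · refine Finset.sum_congr rfl fun j _ => ?_
          simp
      rw [show 2 ^ (m + 1) = N + N by rw [pow_succ, hN]; ring,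
        Finset.sum_range_add (fun k => ‖∑ j ∈ Finset.range (N + N), x j * _‖ ^ 2),
        Finset.sum_range_add (fun j => ‖x j‖ ^ 2),
        ← Finset.sum_add_distrib,
        Finset.sum_congr rfl fun k hk => by rw [e1 k hk, e2 k hk, norm_sq_add_sub]]
      rw [← Finset.mul_sum, Finset.sum_add_distrib, h2, h2 fun j => x (N + j)]
      ring

end Hadamard

/-! ### Infinite sums and optimality of the exponents. -/

section Main

variable {𝕜 : Type*} [RCLike 𝕜] {p q : ℝ≥0∞} [Fact (1 ≤ p)] [Fact (1 ≤ q)]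

theorem matrixFormBound_apply_seqBasis (A : BilinForms 𝕜 p q) (n m : ℕ) :
    MatrixFormBound (fun j k => A (seqBasis 𝕜 p j) (seqBasis 𝕜 q k)) n m (1 / p).toReal
      (1 / q).toReal ‖A‖ := by
  intro x y t τ ht hτ hx hy
  have e : ∑ j ∈ Finset.range n, ∑ k ∈ Finset.range m,
      x j * y k * A (seqBasis 𝕜 p j) (seqBasis 𝕜 q k) =
      A (∑ j ∈ Finset.range n, x j • seqBasis 𝕜 p j)
        (∑ k ∈ Finset.range m, y k • seqBasis 𝕜 q k) := by
    rw [Finset.sum_comm]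
    simp [mul_assoc, mul_left_comm, Finset.mul_sum]
  rw [e]
  refine (A.le_opNorm₂ _ _).trans ?_
  have hS : 0 ≤ ∑ j ∈ Finset.range n, t j := Finset.sum_nonneg fun j _ => ht j
  have := norm_sum_smul_seqBasis_le (p := p) n ht hx
  have := norm_sum_smul_seqBasis_le (p := q) m hτ hy
  gcongr

theorem mixedSum_two_le (hp : 2 ≤ p) (hq : 2 ≤ q) (hpq : 1 / p + 1 / q < 1)
    (A : BilinForms 𝕜 p q) : mixedSum A 2 (hlExponent p q) ≤ ENNReal.ofReal (2 * ‖A‖) := by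
  have hl := hlExponent_pos hp hq hpq
  have h0 : 0 ≤ 2 * ‖A‖ := by positivity
  rw [mixedSum, one_div, ENNReal.rpow_inv_le_iff hl, ENNReal.ofReal_rpow_of_nonneg h0 hl.le]
  -- Truncate the outer sum first; then only finitely many inner series pass to the limit, by
  -- continuity of powers.
  refine ENNReal.tsum_le_of_sum_range_le fun m => ?_
  have hlim : Tendsto (fun n => ∑ k ∈ Finset.range m, (∑ j ∈ Finset.range n,
      ‖A (seqBasis 𝕜 p j) (seqBasis 𝕜 q k)‖ₑ ^ (2 : ℝ)) ^ (hlExponent p q / 2)) atTop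
      (𝓝 (∑ k ∈ Finset.range m, (∑' j,
        ‖A (seqBasis 𝕜 p j) (seqBasis 𝕜 q k)‖ₑ ^ (2 : ℝ)) ^ (hlExponent p q / 2))) :=
    tendsto_finsetSum _ fun k _ =>
      (ENNReal.continuous_rpow_const.tendsto _).comp (ENNReal.tendsto_nat_tsum _)
  refine le_of_tendsto' hlim fun n => ?_
  have h := (matrixFormBound_apply_seqBasis A n m).sum_sqrt_rpow_le (norm_nonneg A)
    ENNReal.toReal_nonneg (toReal_one_div_le_half hp) (toReal_one_div_add_lt_one hp hq hpq)
  refine le_trans (le_of_eq ?_) (ENNReal.ofReal_le_ofReal h)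
  rw [ENNReal.ofReal_sum_of_nonneg fun k _ => by positivity]
  refine Finset.sum_congr rfl fun k _ => ?_
  have hS : 0 ≤ ∑ j ∈ Finset.range n, ‖A (seqBasis 𝕜 p j) (seqBasis 𝕜 q k)‖ ^ 2 :=
    Finset.sum_nonneg fun j _ => sq_nonneg _
  change _ = ENNReal.ofReal (_ ^ hlExponent p q)
  rw [Real.sqrt_eq_rpow, ← Real.rpow_mul hS, one_div_mul_eq_div,
    ← ENNReal.ofReal_rpow_of_nonneg hS (by positivity),
    ENNReal.ofReal_sum_of_nonneg fun j _ => sq_nonneg _]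
  congr 1
  refine Finset.sum_congr rfl fun j _ => ?_
  rw [ENNReal.ofReal_pow (norm_nonneg _), ofReal_norm, ENNReal.rpow_two]

theorem le_mixedSum (A : BilinForms 𝕜 p q) {r s b : ℝ} (hr : 0 < r) (hs : 0 < s) (n : ℕ)
    (hb : 0 ≤ b)
    (h : ∀ k < n, ENNReal.ofReal b ≤ ∑' j, ‖A (seqBasis 𝕜 p j) (seqBasis 𝕜 q k)‖ₑ ^ r) :
    ENNReal.ofReal ((n : ℝ) ^ (1 / s) * b ^ (1 / r)) ≤ mixedSum A r s := by
  have hsr : 0 < s / r := by positivity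
  have e : (n : ℝ) ^ (1 / s) * b ^ (1 / r) = (n * b ^ (s / r)) ^ (1 / s) := by
    rw [Real.mul_rpow (by positivity) (by positivity), ← Real.rpow_mul hb]
    congr 2
    field_simp
  rw [e, mixedSum, ← ENNReal.ofReal_rpow_of_nonneg (by positivity) (by positivity)]
  refine ENNReal.rpow_le_rpow ?_ (by positivity)
  refine le_trans ?_ (ENNReal.sum_le_tsum (Finset.range n))
  rw [ENNReal.ofReal_mul (by positivity), ENNReal.ofReal_natCast,
    ← ENNReal.ofReal_rpow_of_nonneg hb hsr.le, ← nsmul_eq_mul]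
  conv_lhs => rw [← Finset.card_range n]
  exact Finset.card_nsmul_le_sum _ _ _ fun k hk =>
    ENNReal.rpow_le_rpow (h k (Finset.mem_range.1 hk)) hsr.le

theorem not_forall_rpow_le {α β C : ℝ} (h : α < β) {f : ℕ → ℕ} (hf : Tendsto f atTop atTop)
    (hf0 : ∀ m, 0 < f m) : ¬ ∀ m, (f m : ℝ) ^ β ≤ C * (f m : ℝ) ^ α := by
  intro hle
  have hlim : Tendsto (fun m => (f m : ℝ) ^ (β - α)) atTop atTop :=
    (tendsto_rpow_atTop (sub_pos.2 h)).comp (tendsto_natCast_atTop_atTop.comp hf)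
  obtain ⟨m, hm⟩ := (hlim.eventually_gt_atTop C).exists
  have h0 : (0 : ℝ) < f m := by exact_mod_cast hf0 m
  rw [Real.rpow_sub h0, lt_div_iff₀ (by positivity)] at hm
  exact hm.not_ge (hle m)

theorem not_mixedSum_le_of_lt_hlExponent (hp : 2 ≤ p) (hq : 2 ≤ q) {s : ℝ} (hs : 0 < s)
    (hsl : s < hlExponent p q) :
    ¬ ∃ C : ℝ, ∀ A : BilinForms 𝕜 p q, mixedSum A 2 s ≤ ENNReal.ofReal (C * ‖A‖) := by
  rintro ⟨C, hC⟩
  -- Diagonal forms of size `m + 1`. The absolute value covers negative `C`.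
  refine not_forall_rpow_le (C := |C|) (one_div_lt_one_div_of_lt hs hsl)
    (tendsto_add_atTop_nat 1) (fun m => m.succ_pos) fun m => ?_
  obtain ⟨A, hA, hAe⟩ := exists_bilinForm (𝕜 := 𝕜) hp hq m.succ_pos
    (fun j k => if j = k then 1 else 0) zero_le_one (fun x y => by
      simp only [mul_ite, mul_one, mul_zero, one_mul]
      simp only [Finset.sum_ite_eq]
      rw [Finset.sum_congr rfl fun j hj => if_pos hj]
      refine (norm_sum_le _ _).trans ?_
      simp only [norm_mul]
      exact Real.sum_mul_le_sqrt_mul_sqrt _ _ _)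
  have h := (le_mixedSum A two_pos hs (m + 1) zero_le_one fun k hk => ?_).trans (hC A)
  · rw [Real.one_rpow, mul_one] at h
    have h' : ENNReal.ofReal (C * ‖A‖) ≤
        ENNReal.ofReal (|C| * ((m + 1 : ℕ) : ℝ) ^ (1 / hlExponent p q)) := by
      refine ENNReal.ofReal_le_ofReal ?_
      rw [one_mul] at hA
      exact (mul_le_mul_of_nonneg_right (le_abs_self C) (norm_nonneg A)).trans (by gcongr)
    exact (ENNReal.ofReal_le_ofReal_iff (by positivity)).1 (h.trans h')
  · refine le_trans ?_ (ENNReal.le_tsum k)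
    rw [hAe k hk k hk]
    simp

theorem not_mixedSum_le_of_lt_two (hp : 2 ≤ p) (hq : 2 ≤ q) (hpq : 1 / p + 1 / q < 1) {r : ℝ}
    (hr : 0 < r) (hr2 : r < 2) :
    ¬ ∃ C : ℝ, ∀ A : BilinForms 𝕜 p q,
      mixedSum A r (hlExponent p q) ≤ ENNReal.ofReal (C * ‖A‖) := by
  rintro ⟨C, hC⟩
  have hl := hlExponent_pos hp hq hpq
  -- With `N = 2 ^ m`, the norm is at most `N ^ (1 / λ + 1 / 2)`, while unimodular entries make
  -- every inner sum at least `N`.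
  refine not_forall_rpow_le (C := |C|) (f := fun m => 2 ^ m)
    (add_lt_add_right (one_div_lt_one_div_of_lt hr hr2) (1 / hlExponent p q))
    (tendsto_pow_atTop_atTop_of_one_lt one_lt_two) (fun m => by positivity) fun m => ?_
  obtain ⟨H, hH1, hH2⟩ := exists_hadamard 𝕜 m
  have hN : 0 < 2 ^ m := by positivity
  obtain ⟨A, hA, hAe⟩ := exists_bilinForm (𝕜 := 𝕜) (K := √(2 ^ m)) hp hq hN H (by positivity)
    (fun x y => by
      have e : ∀ k, ∑ j ∈ Finset.range (2 ^ m), x j * y k * H j k =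
          (∑ j ∈ Finset.range (2 ^ m), x j * H j k) * y k := by
        intro k
        rw [Finset.sum_mul]
        exact Finset.sum_congr rfl fun j _ => mul_right_comm _ _ _
      rw [Finset.sum_comm, ← Real.sqrt_mul (by positivity), ← hH2]
      simp only [e]
      refine (norm_sum_le _ _).trans ?_
      simp only [norm_mul]
      exact Real.sum_mul_le_sqrt_mul_sqrt _ _ _)
  have h := (le_mixedSum A hr hl (2 ^ m) (b := 2 ^ m) (by positivity) fun k hk => ?_).trans (hC A)
  · have h' : ENNReal.ofReal (C * ‖A‖) ≤ ENNReal.ofReal (|C| * (√(2 ^ m) *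
        ((2 ^ m : ℕ) : ℝ) ^ (1 / hlExponent p q))) := by
      refine ENNReal.ofReal_le_ofReal ?_
      exact (mul_le_mul_of_nonneg_right (le_abs_self C) (norm_nonneg A)).trans (by gcongr)
    have h2 := (ENNReal.ofReal_le_ofReal_iff (by positivity)).1 (h.trans h')
    push_cast at h2 ⊢
    rwa [Real.rpow_add (by positivity), Real.rpow_add (by positivity), ← Real.sqrt_eq_rpow,
      mul_comm _ √(2 ^ m)]
  · refine le_trans ?_ (ENNReal.sum_le_tsum (Finset.range (2 ^ m)))
    rw [Finset.sum_congr rfl fun j hj => by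
      rw [hAe j (Finset.mem_range.1 hj) k hk, ← ofReal_norm, hH1]]
    simp [ENNReal.ofReal_pow]

end Main

theorem mainTheorem3 (𝕜 : Type*) [RCLike 𝕜] (p q : ℝ≥0∞) [Fact (1 ≤ p)] [Fact (1 ≤ q)]
    (hp : 2 ≤ p) (hq : 2 ≤ q) (hpq : 1 / p + 1 / q < 1) :
    (∃ C : ℝ, 1 ≤ C ∧ ∀ A : BilinForms 𝕜 p q,
      mixedSum A 2 (hlExponent p q) ≤ ENNReal.ofReal (C * ‖A‖)) ∧
    (∀ s : ℝ, 0 < s → s < hlExponent p q →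
      ¬ ∃ C : ℝ, ∀ A : BilinForms 𝕜 p q, mixedSum A 2 s ≤ ENNReal.ofReal (C * ‖A‖)) ∧
    (∀ r : ℝ, 0 < r → r < 2 →
      ¬ ∃ C : ℝ, ∀ A : BilinForms 𝕜 p q,
        mixedSum A r (hlExponent p q) ≤ ENNReal.ofReal (C * ‖A‖)) :=
  ⟨⟨2, one_le_two, mixedSum_two_le hp hq hpq⟩,
    fun _ hs hsl => not_mixedSum_le_of_lt_hlExponent hp hq hs hsl,
    fun _ hr hr2 => not_mixedSum_le_of_lt_two hp hq hpq hr hr2⟩
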